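/- For an integer matrix $E\in\mathbb Z^{d\times n}$, the Graver basis $\mathcal G(E)$ is the set of all nonzero $v\in\ker(E)\cap\mathbb Z^n$ that cannot be written as $v=v'+v''$ with nonzero $v',v''\in\ker(E)\cap\mathbb Z^n$ lying in the same orthant as $v$ (that is, in each coordinate $v,v',v''$ are all $\ge 0$ or all $\le 0$). For $A\in\mathbb Z^{d_A\times n_A}$, $B\in\mathbb Z^{d_A\times n_B}$, $C\in\mathbb Z^{d_C\times n_B}$, $D\in\mathbb Z^{d_C\times n_A}$ and $N\in\mathbb Z_{\ge 0}$ let $$\begin{pmatrix}C&D\\B&A\end{pmatrix}^{(N)}:=\begin{pmatrix}C&D&D&\cdots&D\\B&A&0&\cdots&0\\B&0&A&&0\\\vdots&&&\ddots&\\B&0&0&\cdots&A\end{pmatrix}$$ with $N$ copies of $A$. Maxima over an empty set are $0$. **Theorem.** Let $A,B,C,D$ be as above. 1. There is a number $g\in\mathbb Z_{\ge 0}$, depending only on $A$ and $B$ and not on $N$, such that for every $N\in\mathbb Z_{\ge0}$ and every $v\in\mathcal G\Big(\begin{pmatrix}0&0\\B&A\end{pmatrix}^{(N)}\Big)$ all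 components of $v$ are bounded by $g$ in absolute value. 2. Let $M\ge 1$ be an integer bounding the absolute values of all entries of $C$ and $D$, and let $g$ be any number as in 1. Then for every $N\in\mathbb Z_{\ge 0}$ $$\begin{aligned}\max\Big\{\|v\|_1: v\in\mathcal G\Big(\begin{pmatrix}C&D\\B&A\end{pmatrix}^{(N)}\Big)\Big\}&\le \big(2(n_B+Nn_A)M\big)^{2^{d_C}-1}\Big(\max\Big\{\|v\|_1: v\in\mathcal G\Big(\begin{pmatrix}0&0\\B&A\end{pmatrix}^{(N)}\Big)\Big\}\Big)^{2^{d_C}}\\&\le \big(2(n_B+Nn_A)M\big)^{2^{d_C}-1}\big((n_B+Nn_A)g\big)^{2^{d_C}}.\end{aligned}$$ 3. Consequently, for fixed $A,B,C,D$, the number $\max\big\{\|v\|_1: v\in\mathcal G\big(\begin{pmatrix}C&D\\B&A\end{pmatrix}^{(N)}\big)\big\}$ is bounded by a polynomial in $N$. -/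

import Mathlib

/-- The 1-norm of an integer vector. -/
def l1Norm {ι : Type*} [Fintype ι] (v : ι → ℤ) : ℕ :=
  ∑ i, (v i).natAbs

/-- The three vectors lie in a common (closed) orthant: in each coordinate they are all nonnegative
or all nonpositive. -/
def InCommonOrthant {ι : Type*} (u v w : ι → ℤ) : Prop :=
  ∀ i, (0 ≤ u i ∧ 0 ≤ v i ∧ 0 ≤ w i) ∨ (u i ≤ 0 ∧ v i ≤ 0 ∧ w i ≤ 0)

/-- The Graver basis of an integer matrix: all nonzero integer vectors `v` of its kernel that are
not the sum of two nonzero integer vectors of the kernel lying in the same orthant as `v`. -/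
def graverBasis {m ι : Type*} [Fintype ι] (A : Matrix m ι ℤ) : Set (ι → ℤ) :=
  {v | A.mulVec v = 0 ∧ v ≠ 0 ∧
    ¬ ∃ v' v'' : ι → ℤ, A.mulVec v' = 0 ∧ A.mulVec v'' = 0 ∧ v' ≠ 0 ∧ v'' ≠ 0 ∧
      v = v' + v'' ∧ InCommonOrthant v v' v''}

/-- The maximum 1-norm of an element of the Graver basis. It is formed in `ℕ∞`: it is `0` if the
Graver basis is empty, and it would be `⊤` if the 1-norms were unbounded. -/
noncomputable def graverDegree {m ι : Type*} [Fintype ι] (A : Matrix m ι ℤ) : ℕ∞ :=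
  ⨆ v ∈ graverBasis A, (l1Norm v : ℕ∞)

/-- The `N`-fold 4-block matrix `(C D; B A)^(N)`: the first block row is `C D D ... D`, and the
`k`-th of the following `N` block rows is `B 0 ... 0 A 0 ... 0`, with `A` in the `k`-th position. -/
def fourBlock {dA dC nA nB : ℕ} (C : Matrix (Fin dC) (Fin nB) ℤ) (D : Matrix (Fin dC) (Fin nA) ℤ)
    (B : Matrix (Fin dA) (Fin nB) ℤ) (A : Matrix (Fin dA) (Fin nA) ℤ) (N : ℕ) :
    Matrix (Fin dC ⊕ Fin N × Fin dA) (Fin nB ⊕ Fin N × Fin nA) ℤ :=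
  Matrix.fromBlocks C
    (Matrix.of fun i q => D i q.2)
    (Matrix.of fun p j => B p.2 j)
    (Matrix.of fun p q => if p.1 = q.1 then A p.2 q.2 else 0)

/-- `g` bounds the absolute values of all components of all Graver basis elements of the two-stage
stochastic matrices `(0 0; B A)^(N)`, simultaneously for all `N`. The number `dC` of zero rows on
top does not change the kernel, hence not the Graver basis; it is taken to be `0` here. -/
def IsStochasticGraverBound {dA nA nB : ℕ} (A : Matrix (Fin dA) (Fin nA) ℤ)
    (B : Matrix (Fin dA) (Fin nB) ℤ) (g : ℕ) : Prop :=
  ∀ N : ℕ, ∀ v ∈ graverBasis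
      (fourBlock (0 : Matrix (Fin 0) (Fin nB) ℤ) (0 : Matrix (Fin 0) (Fin nA) ℤ) B A N),
    ∀ i, |v i| ≤ (g : ℤ)

/-! ### Families of subsets of `ℕ ^ σ` -/

section UpperSets

variable {σ : Type*} [Finite σ]

theorem exists_finite_subset_forall_le (S : Set (σ → ℕ)) :
    ∃ F ⊆ S, F.Finite ∧ ∀ y ∈ S, ∃ x ∈ F, x ≤ y := by
  refine ⟨{x | Minimal (· ∈ S) x}, fun x hx => hx.prop, ?_, fun y hy => ?_⟩
  · exact WellQuasiOrderedLE.finite_of_isAntichain (setOfPred_minimal_antichain (· ∈ S))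
  · obtain ⟨m, hm, hmin⟩ := exists_minimal_le_of_wellFoundedLT (· ∈ S) y hy
    exact ⟨m, hmin, hm⟩

/-- The complement of a finitely generated upper set is a finite union of boxes. -/
theorem exists_finite_boxes {F : Set (σ → ℕ)} (hF : F.Finite) :
    ∃ s : Set (σ → WithTop ℕ), s.Finite ∧
      ∀ x : σ → ℕ, (∀ u ∈ F, ¬ u ≤ x) ↔ ∃ c ∈ s, ∀ k, (x k : WithTop ℕ) < c k := by
  classical
  induction F, hF using Set.Finite.induction_on with
  | empty =>
    exact ⟨{fun _ => ⊤}, Set.finite_singleton _, fun x => by simp⟩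
  | @insert u F _ _ ih =>
    obtain ⟨s, hs, h⟩ := ih
    refine ⟨Set.image2 (fun c k => c ⊓ Function.update ⊤ k (u k : WithTop ℕ)) s Set.univ,
      hs.image2 _ Set.finite_univ, fun x => ?_⟩
    have key : ∀ (c : σ → WithTop ℕ) (k : σ),
        (∀ j, (x j : WithTop ℕ) < (c ⊓ Function.update ⊤ k (u k : WithTop ℕ)) j) ↔
          (∀ j, (x j : WithTop ℕ) < c j) ∧ x k < u k := by
      intro c k
      constructor
      · intro hc
        refine ⟨fun j => (lt_inf_iff.1 (hc j)).1, ?_⟩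
        have := (lt_inf_iff.1 (hc k)).2
        simpa using this
      · rintro ⟨hc, hk⟩ j
        refine lt_inf_iff.2 ⟨hc j, ?_⟩
        by_cases hj : j = k
        · subst hj; simpa using hk
        · simp [hj]
    constructor
    · intro hx
      obtain ⟨c, hc, hxc⟩ := (h x).1 fun v hv => hx v (Set.mem_insert_of_mem _ hv)
      have hu := hx u (Set.mem_insert _ _)
      rw [Pi.le_def] at hu
      push Not at hu
      obtain ⟨k, hk⟩ := hu
      exact ⟨_, Set.mem_image2_of_mem hc (Set.mem_univ k), (key c k).2 ⟨hxc, hk⟩⟩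
    · rintro ⟨_, ⟨c, hc, k, -, rfl⟩, hx⟩ v hv
      obtain ⟨hxc, hk⟩ := (key c k).1 hx
      rcases Set.mem_insert_iff.1 hv with rfl | hv
      · exact fun hle => absurd (hle k) (not_le.2 hk)
      · exact (h x).2 ⟨c, hc, hxc⟩ v hv

theorem List.SublistForall₂.exists_of_mem {α β : Type*} {R : α → β → Prop} {l₁ : List α}
    {l₂ : List β} (h : List.SublistForall₂ R l₁ l₂) : ∀ a ∈ l₁, ∃ b ∈ l₂, R a b := by
  induction h with
  | nil => simp
  | cons hab _ ih =>
    intro a ha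
    rcases List.mem_cons.1 ha with rfl | ha
    · exact ⟨_, List.mem_cons_self, hab⟩
    · obtain ⟨b, hb, h⟩ := ih a ha
      exact ⟨b, List.mem_cons_of_mem _ hb, h⟩
  | cons_right _ ih =>
    intro a ha
    obtain ⟨b, hb, h⟩ := ih a ha
    exact ⟨b, List.mem_cons_of_mem _ hb, h⟩

/-- Reverse inclusion of upper sets in `ℕ ^ σ` is a well-quasi-order, stated for generating sets. -/
theorem exists_lt_forall_exists_le (f : ℕ → Set (σ → ℕ)) :
    ∃ i j, i < j ∧ ∀ y ∈ f j, ∃ x ∈ f i, x ≤ y := by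
  have hbox : ∀ i, ∃ l : List (σ → WithTop ℕ), ∀ x : σ → ℕ,
      (∀ u ∈ f i, ¬ u ≤ x) ↔ ∃ c ∈ l, ∀ k, (x k : WithTop ℕ) < c k := by
    intro i
    obtain ⟨F, hFs, hF, hmin⟩ := exists_finite_subset_forall_le (f i)
    obtain ⟨s, hs, h⟩ := exists_finite_boxes hF
    refine ⟨hs.toFinset.toList, fun x => ?_⟩
    simp only [Finset.mem_toList, Set.Finite.mem_toFinset]
    rw [← h x]
    refine ⟨fun hx u hu => hx u (hFs hu), fun hx u hu hux => ?_⟩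
    obtain ⟨w, hw, hwu⟩ := hmin u hu
    exact hx w hw (hwu.trans hux)
  choose l hl using hbox
  have hpwo : (Set.univ : Set (σ → WithTop ℕ)).PartiallyWellOrderedOn (· ≤ ·) :=
    Set.isPWO_of_wellQuasiOrderedLE _
  obtain ⟨i, j, hij, hR⟩ := Set.PartiallyWellOrderedOn.exists_lt
    (hpwo.partiallyWellOrderedOn_sublistForall₂ (· ≤ ·)) (f := l) (fun n x _ => Set.mem_univ x)
  refine ⟨i, j, hij, fun y hy => ?_⟩
  by_contra hcon
  push Not at hcon
  obtain ⟨c, hc, hyc⟩ := (hl i y).1 hcon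
  obtain ⟨c', hc', hcc'⟩ := hR.exists_of_mem c hc
  exact (hl j y).2 ⟨c', hc', fun k => (hyc k).trans_le (hcc' k)⟩ y hy le_rfl

end UpperSets

/-! ### The conformal order and Graver elements of a lattice -/

section Conformal

variable {ι : Type*}

/-- `w` lies between `0` and `v` in every coordinate. -/
def ConformalLE (w v : ι → ℤ) : Prop :=
  ∀ i, (0 ≤ w i ∧ w i ≤ v i) ∨ (v i ≤ w i ∧ w i ≤ 0)

/-- `w` lies in every closed orthant containing `v`. -/
def SameSign (v w : ι → ℤ) : Prop :=
  ∀ i, (0 ≤ v i → 0 ≤ w i) ∧ (v i ≤ 0 → w i ≤ 0)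

theorem ConformalLE.sameSign {v w : ι → ℤ} (h : ConformalLE w v) : SameSign v w := by
  intro i; have := h i; omega

theorem ConformalLE.sub {v w : ι → ℤ} (h : ConformalLE w v) : ConformalLE (v - w) v := by
  intro i; have := h i; simp only [Pi.sub_apply]; omega

theorem conformal_self (v : ι → ℤ) : ConformalLE v v := by
  intro i; omega

theorem SameSign.trans {u v w : ι → ℤ} (h : SameSign u v) (h' : SameSign v w) : SameSign u w :=
  fun i => ⟨fun hi => (h' i).1 ((h i).1 hi), fun hi => (h' i).2 ((h i).2 hi)⟩

theorem SameSign.sum {α : Type*} {v : ι → ℤ} {w : α → ι → ℤ} (h : ∀ a, SameSign v (w a))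
    (s : Finset α) : SameSign v (∑ a ∈ s, w a) := by
  intro i
  rw [Finset.sum_apply]
  exact ⟨fun hi => Finset.sum_nonneg fun a _ => (h a i).1 hi,
    fun hi => Finset.sum_nonpos fun a _ => (h a i).2 hi⟩

theorem conformal_add {v w u : ι → ℤ} (hw : SameSign v w) (hu : SameSign v u) (h : v = w + u) :
    ConformalLE w v := by
  intro i
  have h1 := hw i
  have h2 := hu i
  have h3 : v i = w i + u i := by rw [h]; rfl
  omega

/-- The Graver elements of a subgroup of `ℤ ^ ι`: its minimal nonzero elements for the conformal
order. -/
def graverElements (K : AddSubgroup (ι → ℤ)) : Set (ι → ℤ) :=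
  {v | v ∈ K ∧ v ≠ 0 ∧ ∀ w ∈ K, ConformalLE w v → w = 0 ∨ w = v}

theorem mem_graverBasis_iff [Fintype ι] {m : Type*} (A : Matrix m ι ℤ) (K : AddSubgroup (ι → ℤ))
    (hK : ∀ v, v ∈ K ↔ A.mulVec v = 0) (v : ι → ℤ) :
    v ∈ graverBasis A ↔ v ∈ graverElements K := by
  simp only [graverBasis, graverElements, Set.mem_ofPred_eq, hK]
  refine and_congr_right fun hv => and_congr_right fun _ => ⟨fun h w hw hwv => ?_, ?_⟩
  · by_contra hcon
    push Not at hcon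
    refine h ⟨w, v - w, hw, by rw [Matrix.mulVec_sub, hv, hw, sub_zero], hcon.1,
      fun h0 => hcon.2 (sub_eq_zero.1 h0).symm, by abel, fun i => ?_⟩
    have := hwv i
    simp only [Pi.sub_apply]
    omega
  · rintro h ⟨w, u, hw, -, hw0, hu0, rfl, ho⟩
    rcases h w hw fun i => by have := ho i; simp only [Pi.add_apply] at this ⊢; omega with h | h
    · exact hw0 h
    · exact hu0 (by simpa using h.symm)

section l1Norm

variable [Fintype ι]

theorem l1Norm_eq_zero {v : ι → ℤ} : l1Norm v = 0 ↔ v = 0 := by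
  simp [l1Norm, funext_iff]

theorem l1Norm_sum_le {α : Type*} (s : Finset α) (w : α → ι → ℤ) :
    l1Norm (∑ a ∈ s, w a) ≤ ∑ a ∈ s, l1Norm (w a) := by
  simp only [l1Norm]
  rw [Finset.sum_comm]
  refine Finset.sum_le_sum fun i _ => ?_
  rw [Finset.sum_apply]
  exact Int.natAbs_sum_le s fun a => w a i

theorem ConformalLE.l1Norm_add {v w : ι → ℤ} (h : ConformalLE w v) :
    l1Norm w + l1Norm (v - w) = l1Norm v := by
  simp only [l1Norm, ← Finset.sum_add_distrib]
  refine Finset.sum_congr rfl fun i _ => ?_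
  have := h i
  simp only [Pi.sub_apply]
  omega

/-- Every lattice vector is a sum of sign-compatible Graver elements. -/
theorem exists_graver_decomposition (K : AddSubgroup (ι → ℤ)) (v : ι → ℤ) (hv : v ∈ K) :
    ∃ (α : Type) (_ : Fintype α) (w : α → ι → ℤ),
      (∀ a, w a ∈ graverElements K ∧ SameSign v (w a)) ∧ ∑ a, w a = v := by
  induction hn : l1Norm v using Nat.strong_induction_on generalizing v with
  | _ n ih =>
    by_cases h0 : v = 0
    · exact ⟨Empty, inferInstance, fun a => a.elim, fun a => a.elim, by simp [h0]⟩
    by_cases hG : v ∈ graverElements K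
    · exact ⟨Unit, inferInstance, fun _ => v, fun _ => ⟨hG, (conformal_self v).sameSign⟩, by simp⟩
    have : ∃ w ∈ K, ConformalLE w v ∧ w ≠ 0 ∧ w ≠ v := by
      by_contra hcon
      push Not at hcon
      exact hG ⟨hv, h0, fun w hw hwv => or_iff_not_imp_left.2 (hcon w hw hwv)⟩
    obtain ⟨w, hw, hwv, hw0, hwv'⟩ := this
    have hadd := hwv.l1Norm_add
    have h1 : l1Norm w ≠ 0 := fun h => hw0 (l1Norm_eq_zero.1 h)
    have h2 : l1Norm (v - w) ≠ 0 := fun h => hwv' (sub_eq_zero.1 (l1Norm_eq_zero.1 h)).symm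
    obtain ⟨α, _, x, hx, hxs⟩ := ih (l1Norm w) (by omega) w hw rfl
    obtain ⟨β, _, y, hy, hys⟩ := ih (l1Norm (v - w)) (by omega) (v - w) (K.sub_mem hv hw) rfl
    refine ⟨α ⊕ β, inferInstance, Sum.elim x y, ?_, ?_⟩
    · rintro (a | b)
      · exact ⟨(hx a).1, hwv.sameSign.trans (hx a).2⟩
      · exact ⟨(hy b).1, hwv.sub.sameSign.trans (hy b).2⟩
    · simp [hxs, hys]

end l1Norm

end Conformal

/-! ### Adding rows -/

/-- One-dimensional Steinitz lemma: a zero-sum family of integers in `[-L, L]` without proper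
nonempty zero-sum subfamilies has at most `2 L` members. -/
theorem Finset.card_le_of_zero_sum_irreducible {α : Type*} (s : Finset α) (x : α → ℤ) (L : ℕ)
    (hL : 1 ≤ L) (hx : ∀ a ∈ s, |x a| ≤ L) (hs : ∑ a ∈ s, x a = 0)
    (hmin : ∀ t ⊆ s, t.Nonempty → ∑ a ∈ t, x a = 0 → t = s) : s.card ≤ 2 * L := by
  classical
  have step : ∀ t : Finset α, t ⊂ s → ∑ a ∈ t, x a ∈ Finset.Icc (1 - L : ℤ) L →
      ∃ a ∈ s \ t, ∑ a ∈ insert a t, x a ∈ Finset.Icc (1 - L : ℤ) L := by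
    intro t ht hsum
    have hrest := Finset.sum_sdiff (f := x) ht.subset
    rw [hs] at hrest
    have hne : (s \ t).Nonempty := Finset.sdiff_nonempty.2 ht.2
    rw [Finset.mem_Icc] at hsum
    have hex : ∃ a ∈ s \ t, (0 < ∑ a ∈ t, x a → x a < 0) ∧ (∑ a ∈ t, x a ≤ 0 → 0 ≤ x a) := by
      by_cases hpos : 0 < ∑ a ∈ t, x a
      · by_contra hcon
        push Not at hcon
        have : 0 ≤ ∑ a ∈ s \ t, x a := Finset.sum_nonneg fun a ha => by
          by_contra hlt
          have := hcon a ha fun _ => by omega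
          omega
        omega
      · by_contra hcon
        push Not at hcon
        have : ∑ a ∈ s \ t, x a < ∑ a ∈ s \ t, (0 : ℤ) :=
          Finset.sum_lt_sum_of_nonempty hne fun a ha => (hcon a ha fun h => absurd h hpos).2
        simp at this
        omega
    obtain ⟨a, ha, h1, h2⟩ := hex
    refine ⟨a, ha, ?_⟩
    have hb := abs_le.1 (hx a (Finset.mem_sdiff.1 ha).1)
    rw [Finset.sum_insert (Finset.mem_sdiff.1 ha).2, Finset.mem_Icc]
    by_cases hpos : 0 < ∑ a ∈ t, x a
    · have := h1 hpos; omega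
    · have := h2 (by omega); omega
  rcases s.eq_empty_or_nonempty with rfl | ⟨a₀, -⟩
  · simp
  have : Nonempty α := ⟨a₀⟩
  choose! g hg hgsum using step
  let T : ℕ → Finset α := fun k => Nat.rec ∅ (fun _ t => insert (g t) t) k
  have hT : ∀ k, T (k + 1) = insert (g (T k)) (T k) := fun k => rfl
  have hinv : ∀ k ≤ s.card, T k ⊆ s ∧ (T k).card = k ∧
      ∑ a ∈ T k, x a ∈ Finset.Icc (1 - L : ℤ) L := by
    intro k
    induction k with
    | zero =>
      intro _
      refine ⟨Finset.empty_subset _, rfl, ?_⟩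
      have h0 : ∑ a ∈ T 0, x a = 0 := Finset.sum_empty
      rw [h0, Finset.mem_Icc]
      omega
    | succ k ih =>
      intro hk
      obtain ⟨h1, h2, h3⟩ := ih (by omega)
      have hss : T k ⊂ s := h1.ssubset_of_ne fun h => by rw [h] at h2; omega
      have hm := Finset.mem_sdiff.1 (hg _ hss h3)
      rw [hT]
      exact ⟨Finset.insert_subset hm.1 h1, by rw [Finset.card_insert_of_notMem hm.2, h2],
        hgsum _ hss h3⟩
  have hmono : Monotone T := monotone_nat_of_le_succ fun k => Finset.subset_insert _ _
  have hne : ∀ j k, j < k → k < s.card → ∑ a ∈ T j, x a ≠ ∑ a ∈ T k, x a := by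
    intro j k hjk hk heq
    have hsub : T j ⊆ T k := hmono hjk.le
    have hd := Finset.sum_sdiff (f := x) hsub
    obtain ⟨k1, k2, -⟩ := hinv k hk.le
    obtain ⟨-, j2, -⟩ := hinv j (by omega)
    have hall := hmin (T k \ T j) (Finset.sdiff_subset.trans k1)
      (Finset.card_pos.1 (by rw [Finset.card_sdiff_of_subset hsub]; omega)) (by omega)
    have := Finset.card_le_card (hall ▸ Finset.sdiff_subset : s ⊆ T k)
    omega
  have hcard := Finset.card_le_card_of_injOn (s := Finset.range s.card)
    (t := Finset.Icc (1 - L : ℤ) L) (fun k => ∑ a ∈ T k, x a)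
    (fun k hk => (hinv k (Finset.mem_range.1 hk).le).2.2) (by
      intro j hj k hk heq
      rw [Finset.coe_range, Set.mem_Iio] at hj hk
      rcases lt_trichotomy j k with h | h | h
      · exact absurd heq (hne j k h hk)
      · exact h
      · exact absurd heq.symm (hne k j h hj))
  rw [Finset.card_range, Int.card_Icc] at hcard
  omega

section Rows

variable {ι : Type*} [Fintype ι]

theorem l1Norm_le_of_graver_inf_ker (K : AddSubgroup (ι → ℤ)) (f : (ι → ℤ) →+ ℤ) (M G : ℕ)
    (hM : 1 ≤ M) (hf : ∀ w, |f w| ≤ (M * l1Norm w : ℕ))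
    (hG : ∀ w ∈ graverElements K, l1Norm w ≤ G) :
    ∀ v ∈ graverElements (K ⊓ f.ker), l1Norm v ≤ 2 * M * G ^ 2 := by
  rintro v ⟨⟨hvK, hvf⟩, hv0, hvmin⟩
  obtain ⟨α, _, w, hw, hsum⟩ := exists_graver_decomposition K v hvK
  have hα : Nonempty α := by
    by_contra hcon
    rw [not_nonempty_iff] at hcon
    exact hv0 (by rw [← hsum]; simp)
  have hG1 : 1 ≤ G := by
    obtain ⟨a⟩ := hα
    have h1 := hG _ (hw a).1
    have h2 : l1Norm (w a) ≠ 0 := fun h => (hw a).1.2.1 (l1Norm_eq_zero.1 h)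
    omega
  have hcard : (Finset.univ : Finset α).card ≤ 2 * (M * G) := by
    classical
    refine Finset.card_le_of_zero_sum_irreducible Finset.univ (fun a => f (w a)) (M * G)
      (Nat.mul_pos hM hG1) (fun a _ => (hf _).trans ?_) ?_ ?_
    · exact_mod_cast Nat.mul_le_mul_left M (hG _ (hw a).1)
    · rw [← map_sum, hsum]; exact hvf
    · intro t _ ht h0
      have hadd : v = ∑ a ∈ t, w a + ∑ a ∈ tᶜ, w a := by
        rw [Finset.sum_add_sum_compl, hsum]
      have hss := fun t => SameSign.sum (fun a => (hw a).2) t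
      have hne : ∀ u : Finset α, u.Nonempty → ∑ a ∈ u, w a ≠ 0 := by
        rintro u ⟨a, ha⟩ h
        refine (hw a).1.2.1 (funext fun i => ?_)
        have hi := congrFun h i
        rw [Finset.sum_apply, Pi.zero_apply] at hi
        rcases le_total 0 (v i) with hv | hv
        · exact (Finset.sum_eq_zero_iff_of_nonneg fun b _ => ((hw b).2 i).1 hv).1 hi a ha
        · exact (Finset.sum_eq_zero_iff_of_nonpos fun b _ => ((hw b).2 i).2 hv).1 hi a ha
      have hmem : ∑ a ∈ t, w a ∈ K ⊓ f.ker :=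
        ⟨K.sum_mem fun a _ => (hw a).1.1, by
          change f _ = 0
          rw [map_sum, h0]⟩
      rcases hvmin _ hmem (conformal_add (hss t) (hss tᶜ) hadd) with h | h
      · exact absurd h (hne t ht)
      · rw [h] at hadd
        have hcompl : ¬ tᶜ.Nonempty := fun hc => hne _ hc (by simpa using hadd.symm)
        rwa [Finset.not_nonempty_iff_eq_empty, Finset.compl_eq_empty_iff] at hcompl
  calc l1Norm v = l1Norm (∑ a, w a) := by rw [hsum]
    _ ≤ ∑ a, l1Norm (w a) := l1Norm_sum_le _ _
    _ ≤ Finset.card (Finset.univ : Finset α) • G :=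
      Finset.sum_le_card_nsmul _ _ _ fun a _ => hG _ (hw a).1
    _ ≤ (2 * (M * G)) * G := Nat.mul_le_mul_right G hcard
    _ = 2 * M * G ^ 2 := by ring

theorem l1Norm_le_of_graver_inf_iInf_ker {κ : Type*} (K : AddSubgroup (ι → ℤ))
    (f : κ → (ι → ℤ) →+ ℤ) (M G : ℕ)
    (hM : 1 ≤ M) (hf : ∀ i w, |f i w| ≤ (M * l1Norm w : ℕ))
    (hG : ∀ w ∈ graverElements K, l1Norm w ≤ G) (s : Finset κ) :
    ∀ v ∈ graverElements (K ⊓ ⨅ i ∈ s, (f i).ker),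
      l1Norm v ≤ (2 * M) ^ (2 ^ s.card - 1) * G ^ (2 ^ s.card) := by
  classical
  induction s using Finset.induction_on with
  | empty => simpa using hG
  | insert a s ha ih =>
    intro v hv
    rw [Finset.iInf_insert, inf_comm (f a).ker, ← inf_assoc] at hv
    refine (l1Norm_le_of_graver_inf_ker _ (f a) M _ hM (hf a) ih v hv).trans (le_of_eq ?_)
    rw [Finset.card_insert_of_notMem ha]
    have h2 : 2 ^ (s.card + 1) - 1 = 1 + (2 ^ s.card - 1) * 2 := by
      have := Nat.one_le_two_pow (n := s.card)
      rw [pow_succ]; omega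
    rw [h2, pow_succ 2 s.card]
    ring

end Rows

/-! ### Finiteness for two-stage stochastic matrices -/

section PosNeg

variable {ι : Type*}

/-- The vector of positive and negative parts. -/
def posNeg (x : ι → ℤ) : ι ⊕ ι → ℕ :=
  Sum.elim (fun i => (x i).toNat) (fun i => (-x i).toNat)

theorem posNeg_le_posNeg {w v : ι → ℤ} : posNeg w ≤ posNeg v ↔ ConformalLE w v := by
  constructor
  · intro h i
    have h1 := h (Sum.inl i)
    have h2 := h (Sum.inr i)
    simp only [posNeg, Sum.elim_inl, Sum.elim_inr] at h1 h2
    omega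
  · rintro h (i | i) <;> have := h i <;> simp only [posNeg, Sum.elim_inl, Sum.elim_inr] <;> omega

theorem posNeg_injective : Function.Injective (posNeg : (ι → ℤ) → ι ⊕ ι → ℕ) := by
  intro x y h
  funext i
  have h1 := posNeg_le_posNeg.1 h.le i
  have h2 := posNeg_le_posNeg.1 h.ge i
  omega

theorem finite_conformal_minimal [Finite ι] (S : Set (ι → ℤ)) :
    {a | a ∈ S ∧ ∀ a' ∈ S, ConformalLE a' a → a' = a}.Finite := by
  refine Set.Finite.of_finite_image (f := posNeg) ?_ posNeg_injective.injOn
  refine WellQuasiOrderedLE.finite_of_isAntichain ?_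
  rintro _ ⟨x, hx, rfl⟩ _ ⟨y, hy, rfl⟩ hne hle
  exact hne (congrArg posNeg (hy.2 x hx.1 (posNeg_le_posNeg.1 hle)))

theorem abs_le_l1Norm [Fintype ι] (v : ι → ℤ) (i : ι) : |v i| ≤ (l1Norm v : ℤ) := by
  rw [Int.abs_eq_natAbs]
  exact_mod_cast Finset.single_le_sum (f := fun i => (v i).natAbs) (fun _ _ => Nat.zero_le _)
    (Finset.mem_univ i)

theorem exists_abs_le_of_finite [Finite ι] {S : Set (ι → ℤ)} (hS : S.Finite) :
    ∃ g : ℕ, ∀ v ∈ S, ∀ i, |v i| ≤ (g : ℤ) := by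
  have := Fintype.ofFinite ι
  obtain ⟨g, hg⟩ := (hS.image l1Norm).bddAbove
  exact ⟨g, fun v hv i => (abs_le_l1Norm v i).trans
    (by exact_mod_cast hg (Set.mem_image_of_mem _ hv))⟩

end PosNeg

section Stochastic

open Matrix

variable {dA nA nB : ℕ} (A : Matrix (Fin dA) (Fin nA) ℤ) (B : Matrix (Fin dA) (Fin nB) ℤ)

/-- The integer kernel of the two-stage stochastic matrix with `N` scenarios. -/
def stochasticKernel (N : ℕ) : AddSubgroup (Fin nB ⊕ Fin N × Fin nA → ℤ) where
  carrier := {v | ∀ k, B *ᵥ (fun j => v (Sum.inl j)) + A *ᵥ (fun l => v (Sum.inr (k, l))) = 0}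
  zero_mem' := fun k => by
    change B *ᵥ 0 + A *ᵥ 0 = 0
    simp
  add_mem' := fun {v w} hv hw k => by
    have h := congrArg₂ (· + ·) (hv k) (hw k)
    change B *ᵥ ((fun j => v (Sum.inl j)) + fun j => w (Sum.inl j)) +
      A *ᵥ ((fun l => v (Sum.inr (k, l))) + fun l => w (Sum.inr (k, l))) = 0
    rw [mulVec_add, mulVec_add, add_add_add_comm]
    simpa using h
  neg_mem' := fun {v} hv k => by
    have h := congrArg Neg.neg (hv k)
    change B *ᵥ (-fun j => v (Sum.inl j)) + A *ᵥ (-fun l => v (Sum.inr (k, l))) = 0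
    rw [mulVec_neg, mulVec_neg, ← neg_add]
    simpa using h

variable {A B} in
theorem mem_stochasticKernel {N : ℕ} {v : Fin nB ⊕ Fin N × Fin nA → ℤ} :
    v ∈ stochasticKernel A B N ↔
      ∀ k, B *ᵥ (fun j => v (Sum.inl j)) + A *ᵥ (fun l => v (Sum.inr (k, l))) = 0 :=
  Iff.rfl

/-- Only finitely many nonzero first-stage parts occur in Graver elements, over all `N`. -/
theorem finite_first_stage_parts :
    {b : Fin nB → ℤ | b ≠ 0 ∧ ∃ N, ∃ v ∈ graverElements (stochasticKernel A B N),
      (fun j => v (Sum.inl j)) = b}.Finite := by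
  by_contra hinf
  let b := Set.Infinite.natEmbedding _ hinf
  obtain ⟨g, hg⟩ := (wellQuasiOrdered_le (α := Fin nB ⊕ Fin nB → ℕ)).exists_monotone_subseq
    fun n => posNeg (b n : Fin nB → ℤ)
  obtain ⟨i, j, hij, h⟩ := exists_lt_forall_exists_le fun n =>
    posNeg '' {a : Fin nA → ℤ | B *ᵥ (b (g n) : Fin nB → ℤ) + A *ᵥ a = 0}
  obtain ⟨-, N, v, hv, hvb⟩ := (b (g j)).2
  have hblock : ∀ k : Fin N, ∃ a : Fin nA → ℤ, B *ᵥ (b (g i) : Fin nB → ℤ) + A *ᵥ a = 0 ∧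
      ConformalLE a fun l => v (Sum.inr (k, l)) := by
    intro k
    have hk : B *ᵥ (b (g j) : Fin nB → ℤ) + A *ᵥ (fun l => v (Sum.inr (k, l))) = 0 := by
      rw [← hvb]
      exact hv.1 k
    obtain ⟨_, ⟨a, ha, rfl⟩, hle⟩ := h _ ⟨_, hk, rfl⟩
    exact ⟨a, ha, posNeg_le_posNeg.1 hle⟩
  choose a ha hav using hblock
  have hconf := posNeg_le_posNeg.1 (hg i j hij.le)
  rcases hv.2.2 (Sum.elim (b (g i) : Fin nB → ℤ) fun q => a q.1 q.2) (fun k => ha k) (by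
    rintro (l | ⟨k, l⟩)
    · have := hconf l
      rwa [← hvb] at this
    · exact hav k l) with h0 | h0
  · exact (b (g i)).2.1 (funext fun l => congrFun h0 (Sum.inl l))
  · have : b (g i) = b (g j) :=
      Subtype.ext ((funext fun l => congrFun h0 (Sum.inl l)).trans hvb)
    exact hij.ne (g.injective (b.injective this))

variable {A B} in
/-- The second-stage parts of a Graver element are zero or minimal. -/
theorem second_stage_part_minimal {N : ℕ} {v : Fin nB ⊕ Fin N × Fin nA → ℤ}
    (hv : v ∈ graverElements (stochasticKernel A B N)) (k : Fin N) {a : Fin nA → ℤ} (ha0 : a ≠ 0)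
    (ha : B *ᵥ (fun j => v (Sum.inl j)) + A *ᵥ a = 0)
    (hav : ConformalLE a fun l => v (Sum.inr (k, l))) : a = fun l => v (Sum.inr (k, l)) := by
  classical
  rcases hv.2.2 (Sum.elim 0 fun q => if q.1 = k then v (Sum.inr (k, q.2)) - a q.2 else 0)
    (fun m => by
      by_cases hm : m = k
      · have h := hv.1 m
        subst hm
        have hA : A *ᵥ ((fun l => v (Sum.inr (m, l))) - a) = 0 := by
          rw [mulVec_sub, sub_eq_zero]
          exact add_left_cancel (h.trans ha.symm)
        change B *ᵥ 0 + A *ᵥ (fun l => if m = m then v (Sum.inr (m, l)) - a l else 0) = 0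
        simp only [if_true, mulVec_zero, zero_add]
        exact hA
      · change B *ᵥ 0 + A *ᵥ (fun l => if m = k then v (Sum.inr (k, l)) - a l else 0) = 0
        simp only [if_neg hm]
        change B *ᵥ 0 + A *ᵥ 0 = 0
        simp)
    (by
      rintro (l | ⟨m, l⟩)
      · simp only [Sum.elim_inl, Pi.zero_apply]; omega
      · simp only [Sum.elim_inr]
        split_ifs with hm
        · subst hm
          exact hav.sub l
        · omega) with h | h
  · funext l
    have := congrFun h (Sum.inr (k, l))
    simp only [Sum.elim_inr, if_true, Pi.zero_apply] at this
    omega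
  · refine absurd (funext fun l => ?_) ha0
    have := congrFun h (Sum.inr (k, l))
    simp only [Sum.elim_inr, if_true] at this
    simp only [Pi.zero_apply]
    omega

theorem exists_bound_stochasticKernel :
    ∃ g : ℕ, ∀ N, ∀ v ∈ graverElements (stochasticKernel A B N), ∀ i, |v i| ≤ (g : ℤ) := by
  have hT := (finite_first_stage_parts A B).insert 0
  obtain ⟨g₁, hg₁⟩ := exists_abs_le_of_finite hT
  obtain ⟨g₂, hg₂⟩ := exists_abs_le_of_finite (hT.biUnion fun b _ =>
    finite_conformal_minimal {a : Fin nA → ℤ | a ≠ 0 ∧ B *ᵥ b + A *ᵥ a = 0})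
  have hfirst : ∀ N, ∀ v ∈ graverElements (stochasticKernel A B N),
      (fun j => v (Sum.inl j)) ∈ insert 0 {b : Fin nB → ℤ | b ≠ 0 ∧ ∃ N,
        ∃ v ∈ graverElements (stochasticKernel A B N), (fun j => v (Sum.inl j)) = b} := by
    intro N v hv
    by_cases h0 : (fun j => v (Sum.inl j)) = 0
    · exact Or.inl h0
    · exact Or.inr ⟨h0, N, v, hv, rfl⟩
  refine ⟨max g₁ g₂, fun N v hv i => ?_⟩
  rw [Nat.cast_max, le_max_iff]
  rcases i with j | ⟨k, l⟩
  · exact Or.inl (hg₁ _ (hfirst N v hv) j)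
  · right
    by_cases h0 : (fun l => v (Sum.inr (k, l))) = 0
    · have : v (Sum.inr (k, l)) = 0 := congrFun h0 l
      simp [this]
    · exact hg₂ _ (Set.mem_biUnion (hfirst N v hv) ⟨⟨h0, hv.1 k⟩, fun a ha hav =>
        second_stage_part_minimal hv k ha.1 ha.2 hav⟩) l

end Stochastic

/-! ### Four-block matrices -/

section FourBlock

open Matrix

variable {dA dC nA nB : ℕ} (A : Matrix (Fin dA) (Fin nA) ℤ) (B : Matrix (Fin dA) (Fin nB) ℤ)
  (C : Matrix (Fin dC) (Fin nB) ℤ) (D : Matrix (Fin dC) (Fin nA) ℤ) (N : ℕ)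

theorem fourBlock_mulVec_inr (v : Fin nB ⊕ Fin N × Fin nA → ℤ) (k : Fin N) (r : Fin dA) :
    (fourBlock C D B A N *ᵥ v) (Sum.inr (k, r)) =
      (B *ᵥ (fun j => v (Sum.inl j)) + A *ᵥ (fun l => v (Sum.inr (k, l)))) r := by
  simp only [fourBlock, mulVec, dotProduct, Fintype.sum_sum_type, fromBlocks_apply₂₁,
    fromBlocks_apply₂₂, of_apply, Pi.add_apply, Fintype.sum_prod_type]
  congr 1
  rw [Finset.sum_eq_single k]
  · simp
  · intro m _ hm
    simp [hm.symm]
  · simp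

/-- The `i`-th row of the top block, as an additive functional. -/
def fourBlockTopRow (i : Fin dC) : (Fin nB ⊕ Fin N × Fin nA → ℤ) →+ ℤ :=
  ((LinearMap.proj (Sum.inl i)).comp (fourBlock C D B A N).mulVecLin).toAddMonoidHom

theorem fourBlockTopRow_apply (i : Fin dC) (v : Fin nB ⊕ Fin N × Fin nA → ℤ) :
    fourBlockTopRow A B C D N i v = (fourBlock C D B A N *ᵥ v) (Sum.inl i) :=
  rfl

theorem mem_kernel_fourBlock (v : Fin nB ⊕ Fin N × Fin nA → ℤ) :
    v ∈ stochasticKernel A B N ⊓ ⨅ i ∈ Finset.univ, (fourBlockTopRow A B C D N i).ker ↔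
      fourBlock C D B A N *ᵥ v = 0 := by
  simp only [AddSubgroup.mem_inf, AddSubgroup.mem_iInf, Finset.mem_univ, true_imp_iff,
    AddMonoidHom.mem_ker, fourBlockTopRow_apply, mem_stochasticKernel]
  constructor
  · rintro ⟨h1, h2⟩
    funext r
    rcases r with i | ⟨k, r⟩
    · exact h2 i
    · rw [fourBlock_mulVec_inr, h1 k]
      rfl
  · intro h
    refine ⟨fun k => funext fun r => ?_, fun i => congrFun h _⟩
    rw [← fourBlock_mulVec_inr A B C D, h]
    rfl

theorem graverBasis_fourBlock : graverBasis (fourBlock C D B A N) =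
    graverElements
      (stochasticKernel A B N ⊓ ⨅ i ∈ Finset.univ, (fourBlockTopRow A B C D N i).ker) :=
  Set.ext (mem_graverBasis_iff _ _ (mem_kernel_fourBlock A B C D N))

theorem graverBasis_fourBlock_zero :
    graverBasis (fourBlock (0 : Matrix (Fin dC) (Fin nB) ℤ) (0 : Matrix (Fin dC) (Fin nA) ℤ) B A N)
      = graverElements (stochasticKernel A B N) := by
  refine Set.ext (mem_graverBasis_iff _ _ fun v => ?_)
  rw [← mem_kernel_fourBlock, AddSubgroup.mem_inf, and_iff_left]
  simp [AddSubgroup.mem_iInf, fourBlockTopRow_apply, fourBlock, mulVec, dotProduct]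

theorem abs_mulVec_le {m ι : Type*} [Fintype ι] (E : Matrix m ι ℤ) (r : m) (M : ℕ)
    (h : ∀ j, |E r j| ≤ (M : ℤ)) (v : ι → ℤ) : |(E *ᵥ v) r| ≤ (M * l1Norm v : ℕ) := by
  simp only [mulVec, dotProduct, l1Norm]
  push_cast
  rw [Finset.mul_sum]
  refine (Finset.abs_sum_le_sum_abs _ _).trans (Finset.sum_le_sum fun j _ => ?_)
  rw [abs_mul]
  exact mul_le_mul_of_nonneg_right (h j) (abs_nonneg _)

theorem l1Norm_le_card_mul {ι : Type*} [Fintype ι] {v : ι → ℤ} {g : ℕ}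
    (h : ∀ i, |v i| ≤ (g : ℤ)) : l1Norm v ≤ Fintype.card ι * g := by
  refine (Finset.sum_le_card_nsmul Finset.univ _ g fun i _ => ?_).trans_eq rfl
  have := h i
  rw [Int.abs_eq_natAbs] at this
  exact_mod_cast this

theorem l1Norm_le_graverDegree {m ι : Type*} [Fintype ι] {E : Matrix m ι ℤ} {v : ι → ℤ}
    (hv : v ∈ graverBasis E) : (l1Norm v : ℕ∞) ≤ graverDegree E :=
  le_iSup₂_of_le (f := fun v (_ : v ∈ graverBasis E) => (l1Norm v : ℕ∞)) v hv le_rfl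

variable {A B} in
theorem graverDegree_fourBlock_zero_le {g : ℕ} (hg : IsStochasticGraverBound A B g) :
    graverDegree (fourBlock (0 : Matrix (Fin dC) (Fin nB) ℤ)
      (0 : Matrix (Fin dC) (Fin nA) ℤ) B A N) ≤ (((nB + N * nA) * g : ℕ) : ℕ∞) := by
  refine iSup₂_le fun v hv => Nat.cast_le.2 ?_
  rw [graverBasis_fourBlock_zero, ← graverBasis_fourBlock_zero (dC := 0)] at hv
  simpa using l1Norm_le_card_mul (hg N v hv)

theorem graverDegree_fourBlock_le {M : ℕ} (hM : 1 ≤ M) (hC : ∀ i j, |C i j| ≤ (M : ℤ))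
    (hD : ∀ i j, |D i j| ≤ (M : ℤ)) {G : ℕ}
    (hG : graverDegree (fourBlock (0 : Matrix (Fin dC) (Fin nB) ℤ)
      (0 : Matrix (Fin dC) (Fin nA) ℤ) B A N) ≤ G) :
    graverDegree (fourBlock C D B A N) ≤
      (((2 * (nB + N * nA) * M) ^ (2 ^ dC - 1) * G ^ (2 ^ dC) : ℕ) : ℕ∞) := by
  refine iSup₂_le fun v hv => Nat.cast_le.2 ?_
  have hcard : 1 ≤ nB + N * nA := by
    by_contra hcon
    have hempty : IsEmpty (Fin nB ⊕ Fin N × Fin nA) := by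
      rw [← Fintype.card_eq_zero_iff]
      simp only [Fintype.card_sum, Fintype.card_prod, Fintype.card_fin]
      omega
    exact hv.2.1 (Subsingleton.elim _ _)
  rw [graverBasis_fourBlock] at hv
  have hbound := l1Norm_le_of_graver_inf_iInf_ker (stochasticKernel A B N)
    (fourBlockTopRow A B C D N) M G hM (fun i w => abs_mulVec_le _ _ M (by
      rintro (j | q)
      · exact hC i j
      · exact hD i q.2) w) (fun w hw => by
      rw [← graverBasis_fourBlock_zero (dC := dC)] at hw
      exact Nat.cast_le.1 ((l1Norm_le_graverDegree hw).trans hG)) Finset.univ v hv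
  rw [Finset.card_univ, Fintype.card_fin] at hbound
  refine hbound.trans (Nat.mul_le_mul_right _ (Nat.pow_le_pow_left ?_ _))
  exact Nat.mul_le_mul_right M (Nat.le_mul_of_pos_right 2 hcard)

theorem exists_isStochasticGraverBound : ∃ g : ℕ, IsStochasticGraverBound A B g := by
  obtain ⟨g, hg⟩ := exists_bound_stochasticKernel A B
  refine ⟨g, fun N v hv => hg N v ?_⟩
  rwa [graverBasis_fourBlock_zero] at hv

theorem exists_entry_bound {m n : Type*} [Finite m] [Finite n] (E : Matrix m n ℤ) :
    ∃ M : ℕ, ∀ i j, |E i j| ≤ (M : ℤ) := by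
  obtain ⟨M, hM⟩ := exists_abs_le_of_finite
    (Set.finite_singleton fun p : m × n => E p.1 p.2)
  exact ⟨M, fun i j => hM _ rfl (i, j)⟩

end FourBlock

theorem theorem2 {dA dC nA nB : ℕ}
    (A : Matrix (Fin dA) (Fin nA) ℤ) (B : Matrix (Fin dA) (Fin nB) ℤ)
    (C : Matrix (Fin dC) (Fin nB) ℤ) (D : Matrix (Fin dC) (Fin nA) ℤ) :
    -- a number `g` depending only on `A` and `B` exists
    (∃ g : ℕ, IsStochasticGraverBound A B g) ∧
    -- the explicit bounds, for every such `g` and every positive bound `M` on the entries of `C, D`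
    (∀ M : ℕ, 1 ≤ M → (∀ i j, |C i j| ≤ (M : ℤ)) → (∀ i j, |D i j| ≤ (M : ℤ)) →
      ∀ g : ℕ, IsStochasticGraverBound A B g → ∀ N : ℕ,
        graverDegree (fourBlock C D B A N) ≤
          ((2 * (nB + N * nA) * M : ℕ) : ℕ∞) ^ (2 ^ dC - 1) *
            graverDegree (fourBlock (0 : Matrix (Fin dC) (Fin nB) ℤ)
              (0 : Matrix (Fin dC) (Fin nA) ℤ) B A N) ^ (2 ^ dC) ∧
        ((2 * (nB + N * nA) * M : ℕ) : ℕ∞) ^ (2 ^ dC - 1) *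
            graverDegree (fourBlock (0 : Matrix (Fin dC) (Fin nB) ℤ)
              (0 : Matrix (Fin dC) (Fin nA) ℤ) B A N) ^ (2 ^ dC) ≤
          (((2 * (nB + N * nA) * M) ^ (2 ^ dC - 1) * ((nB + N * nA) * g) ^ (2 ^ dC) : ℕ) : ℕ∞)) ∧
    -- for fixed `A, B, C, D` the maximum is bounded by a polynomial in `N`
    (∃ p : Polynomial ℕ, ∀ N : ℕ,
      graverDegree (fourBlock C D B A N) ≤ ((p.eval N : ℕ) : ℕ∞)) := by
  have hbound : ∀ M : ℕ, 1 ≤ M → (∀ i j, |C i j| ≤ (M : ℤ)) → (∀ i j, |D i j| ≤ (M : ℤ)) →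
      ∀ g : ℕ, IsStochasticGraverBound A B g → ∀ N : ℕ,
        graverDegree (fourBlock C D B A N) ≤
          (((2 * (nB + N * nA) * M) ^ (2 ^ dC - 1) * ((nB + N * nA) * g) ^ (2 ^ dC) : ℕ) : ℕ∞) :=
    fun M hM hC hD g hg N =>
      graverDegree_fourBlock_le A B C D N hM hC hD (graverDegree_fourBlock_zero_le N hg)
  refine ⟨exists_isStochasticGraverBound A B, fun M hM hC hD g hg N => ?_, ?_⟩
  · have hle := graverDegree_fourBlock_zero_le (dC := dC) N hg
    obtain ⟨G, hG⟩ := ENat.ne_top_iff_exists.1 (ne_top_of_le_ne_top (ENat.natCast_ne_top _) hle)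
    have hmain := graverDegree_fourBlock_le A B C D N hM hC hD hG.ge
    rw [← hG] at hle ⊢
    refine ⟨by exact_mod_cast hmain, ?_⟩
    have hGn := Nat.cast_le.1 hle
    exact_mod_cast Nat.mul_le_mul_left _ (Nat.pow_le_pow_left hGn _)
  · obtain ⟨g, hg⟩ := exists_isStochasticGraverBound A B
    obtain ⟨M₁, hM₁⟩ := exists_entry_bound C
    obtain ⟨M₂, hM₂⟩ := exists_entry_bound D
    refine ⟨(2 * ((nB : Polynomial ℕ) + Polynomial.X * (nA : Polynomial ℕ)) *
      ((M₁ + M₂ + 1 : ℕ) : Polynomial ℕ)) ^ (2 ^ dC - 1) *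
      (((nB : Polynomial ℕ) + Polynomial.X * (nA : Polynomial ℕ)) * (g : Polynomial ℕ)) ^ (2 ^ dC),
      fun N => ?_⟩
    refine (hbound (M₁ + M₂ + 1) (by omega) (fun i j => (hM₁ i j).trans ?_)
      (fun i j => (hM₂ i j).trans ?_) g hg N).trans_eq ?_
    · push_cast; omega
    · push_cast; omega
    · congr 1
      simp
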